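/- Let $\mathfrak X=C_2^n=\{0,1\}^n$ and let $G=S_n$ act on it by permuting coordinates. For $x\in\mathfrak X$ let $G_x$ be its stabilizer and $\mathcal O_x$ its orbit, and for $s\in G$ let $\mathfrak X_s$ be the set of points of $\mathfrak X$ fixed by $s$. The binary Burnside process is the Markov chain on $\mathfrak X$ with transition matrix and stationary distribution $$K(x,y)=\frac1{|G_x|}\sum_{s\in G_x\cap G_y}\frac1{|\mathfrak X_s|},\qquad \pi(x)=\frac1{Z\,|\mathcal O_x|},$$ where $Z$ is the number of orbits. For an integer $\ell\ge 0$ and $x \in \mathfrak X$ put $$\chi_x^2(\ell)=\sum_{y\in\mathfrak X}\frac{(K^\ell(x,y)-\pi(y))^2}{\pi(y)},\qquad \chi^2_{\mathrm{avg}}(\ell)=\sum_{x\in\mathfrak X}\pi(x)\,\chi_x^2(\ell).$$ **Theorem 1.1.** 1. For all integers $n\ge 0$ and $\ell\ge 1$, $$\chi^2_{\mathrm{avg}}(\ell)=\sum_{k=1}^{\lfloor n/2\rfloor}\binom n{2k}\left(\frac1{2^{4k}}\binom{2k}{k}^2\right)^{2\ell}.$$ 2. As $n\to\infty$, $\chi^2_{\mathrm{avg}}(\ell)\to\infty$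 uniformly over integers $0\le\ell\le\frac{0.1\,n}{\log n}$. Moreover, if $x^{(n)}\in C_2^n$ is the state with $\lfloor n/2\rfloor$ zeros followed by $\lceil n/2\rceil$ ones, then $\chi^2_{x^{(n)}}(\ell)\to\infty$ uniformly over the same $\ell$. That is, for every real $M$ there is $N$ such that for all $n\ge N$ and all such $\ell$, $\chi^2_{\mathrm{avg}}(\ell)\ge M$ and $\chi^2_{x^{(n)}}(\ell)\ge M$. 3. As $n\to\infty$, $\chi^2_{\mathrm{avg}}(\ell)\to0$ uniformly over integers $\ell\ge\frac{10\,n}{\log n}$, and $\chi^2_x(\ell)\to0$ uniformly over the same $\ell$ and over all starting states $x\in C_2^n$. That is, for every $\varepsilon>0$ there is $N$ such that for all $n\ge N$, all such $\ell$ and all $x\in C_2^n$, $\chi^2_{\mathrm{avg}}(\ell)<\varepsilon$ and $\chi^2_x(\ell)<\varepsilon$. -/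

import Mathlib

open Filter

/-- Transition matrix of the Burnside process of a finite group `G` acting on a finite set `X`:
from `x`, pick `s` uniformly in the stabilizer of `x`, then `y` uniformly among the points fixed
by `s`. Thus `K(x, y) = |G_x|⁻¹ ∑_{s ∈ G_x ∩ G_y} |X_s|⁻¹`. -/
noncomputable def burnsideKernel (G X : Type*) [Group G] [Fintype G] [DecidableEq X]
    [MulAction G X] : Matrix X X ℝ :=
  Matrix.of fun x y =>
    (1 / (Nat.card (MulAction.stabilizer G x) : ℝ)) *
      ∑ s : G with s • x = x ∧ s • y = y, 1 / (Nat.card (MulAction.fixedBy X s) : ℝ)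

/-- Stationary distribution of the Burnside process: `π(x) = 1 / (Z |O_x|)`, where `Z` is the
number of orbits and `O_x` the orbit of `x`. -/
noncomputable def burnsideStationary (G X : Type*) [Group G] [MulAction G X] (x : X) : ℝ :=
  1 / ((Nat.card (MulAction.orbitRel.Quotient G X) : ℝ) * (Nat.card (MulAction.orbit G x) : ℝ))

/-- Chi-square distance after `l` steps from `x`:
`∑_y (K^l(x, y) - π(y))² / π(y)`. -/
noncomputable def chiSqDist {X : Type*} [Fintype X] [DecidableEq X]
    (K : Matrix X X ℝ) (π : X → ℝ) (l : ℕ) (x : X) : ℝ :=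
  ∑ y, ((K ^ l) x y - π y) ^ 2 / π y

/-- Binary `n`-tuples. -/
abbrev BinaryTuple (n : ℕ) : Type := Fin n → Fin 2

/-- The symmetric group acting on functions on `Fin n` by permuting coordinates. (`DomMulAct` is
the type synonym carrying Mathlib's action by precomposition with a permutation.) -/
abbrev CoordPerm (n : ℕ) : Type := (Equiv.Perm (Fin n))ᵈᵐᵃ

instance coordPermFintype (n : ℕ) : Fintype (CoordPerm n) :=
  Fintype.ofEquiv (Equiv.Perm (Fin n)) DomMulAct.mk

/-- Chi-square distance `χ²_x(l)` of the binary Burnside process on `n`-tuples. -/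
noncomputable def binaryChiSq (n l : ℕ) (x : BinaryTuple n) : ℝ :=
  chiSqDist (burnsideKernel (CoordPerm n) (BinaryTuple n))
    (burnsideStationary (CoordPerm n) (BinaryTuple n)) l x

/-- Average chi-square distance `∑_x π(x) χ²_x(l)` of the binary Burnside process. -/
noncomputable def binaryChiSqAvg (n l : ℕ) : ℝ :=
  ∑ x : BinaryTuple n, burnsideStationary (CoordPerm n) (BinaryTuple n) x * binaryChiSq n l x

/-- The state with `⌊n/2⌋` zeros followed by `⌈n/2⌉` ones. -/
def halfState (n : ℕ) : BinaryTuple n := fun i => if (i : ℕ) < n / 2 then 0 else 1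

/-! ### Chi-square distance for reversible chains -/

section Reversible

variable {X : Type*} [Fintype X] [DecidableEq X] {K : Matrix X X ℝ} {π : X → ℝ}

/-! Reversibility turns the chi-square distance into a return probability, `K^(2l) x x / π x - 1`,
so its average is `trace (K^(2l)) - 1`, and the first claim becomes a trace computation.

By a cycle-by-cycle recursion, the weights `1 / |X_s|` over the permutations preserving both `x` and
`y` sum to a product of rising factorials of 1/2, one for each of the four classes of coordinates
(`burnsideKernel_coordPerm`). These are Beta(1/2, 1/2) moments, so a step from `x` has a simple
description: draw independent arcsine variables `U₀, U₁` on [-1, 1], then draw the new bits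
independently, with sign of mean `U₀` where `x` is 0 and `U₁` where `x` is 1
(`burnsideKernel_eq_arcsineExpect₂`). Expanding in Walsh characters factors `K` as `A * B`. The
product `B * A` has the same traces of positive powers and is triangular for inclusion of sets, with
diagonal entry `2^(-s) E (U₀ - U₁)^s` at a set of size `s`. This vanishes for odd `s` and is the
stated eigenvalue for `s = 2k`.

The lower bounds need no spectrum: `K x x ≥ 1/n²` keeps return probabilities above `exp (-0.4 n)` in
the given range, while both the state space and the orbit of the half state have size at least `2^n
/ (n + 1)`. For the upper bounds, the eigenvalue is at most `1/(2k+1)`, which makes every term of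
the sum at most `exp (-√n)`. Each orbit has mass `1/Z` with `Z ≤ n + 1`, so passing to a fixed start
costs only a factor `n + 1`. -/

theorem Matrix.sum_pow_apply_eq_one (hK : ∀ x, ∑ y, K x y = 1) (l : ℕ) (x : X) :
    ∑ y, (K ^ l) x y = 1 := by
  induction l generalizing x with
  | zero => simp [Matrix.one_apply]
  | succ l ih =>
    simp only [pow_succ, Matrix.mul_apply]
    rw [Finset.sum_comm]
    simp [← Finset.mul_sum, hK, ih]

theorem Matrix.detailedBalance_pow (hK : ∀ x y, π x * K x y = π y * K y x) (l : ℕ) (x y : X) :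
    π x * (K ^ l) x y = π y * (K ^ l) y x := by
  induction l generalizing x y with
  | zero =>
    by_cases h : x = y
    · rw [h]
    · simp [h, Ne.symm h]
  | succ l ih =>
    rw [pow_succ, Matrix.mul_apply, ← pow_succ, pow_succ', Matrix.mul_apply, Finset.mul_sum,
      Finset.mul_sum]
    refine Finset.sum_congr rfl fun z _ => ?_
    rw [← mul_assoc, ih, mul_right_comm, hK, mul_assoc]

/-- For a reversible chain the chi-square distance is a return probability. -/
theorem chiSqDist_eq_return (hpos : ∀ x, 0 < π x) (hsum : ∑ x, π x = 1)
    (hK : ∀ x, ∑ y, K x y = 1) (hrev : ∀ x y, π x * K x y = π y * K y x) (l : ℕ) (x : X) :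
    chiSqDist K π l x = (K ^ (2 * l)) x x / π x - 1 := by
  have h : ∀ y, ((K ^ l) x y - π y) ^ 2 / π y
      = (K ^ l) x y * (K ^ l) y x / π x - 2 * (K ^ l) x y + π y := by
    intro y
    have h1 := (hpos y).ne'
    have h2 := (hpos x).ne'
    have h3 := Matrix.detailedBalance_pow hrev l x y
    field_simp
    linear_combination (K ^ l) x y * h3
  simp only [chiSqDist, h, Finset.sum_add_distrib, Finset.sum_sub_distrib, ← Finset.mul_sum,
    ← Finset.sum_div, Matrix.sum_pow_apply_eq_one hK, hsum, two_mul l, pow_add, Matrix.mul_apply]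
  ring

theorem chiSqDist_nonneg (hpos : ∀ x, 0 < π x) (l : ℕ) (x : X) : 0 ≤ chiSqDist K π l x :=
  Finset.sum_nonneg fun y _ => div_nonneg (sq_nonneg _) (hpos y).le

/-- The weight `π x` cancels the denominator of the return-probability formula, leaving the diagonal
entries. -/
theorem sum_mul_chiSqDist (hpos : ∀ x, 0 < π x) (hsum : ∑ x, π x = 1)
    (hK : ∀ x, ∑ y, K x y = 1) (hrev : ∀ x y, π x * K x y = π y * K y x) (l : ℕ) :
    ∑ x, π x * chiSqDist K π l x = (K ^ (2 * l)).trace - 1 := by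
  rw [Matrix.trace, ← hsum, ← Finset.sum_sub_distrib]
  refine Finset.sum_congr rfl fun x _ => ?_
  have := (hpos x).ne'
  rw [chiSqDist_eq_return hpos hsum hK hrev, Matrix.diag_apply]
  field_simp

/-- Never moving is one of the ways to return. -/
theorem Matrix.pow_diag_le_pow_apply (hK : ∀ x y, 0 ≤ K x y) (l : ℕ) (x : X) :
    K x x ^ l ≤ (K ^ l) x x := by
  induction l with
  | zero => simp
  | succ l ih =>
    rw [pow_succ, pow_succ, Matrix.mul_apply]
    exact (mul_le_mul_of_nonneg_right ih (hK x x)).trans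
      (Finset.single_le_sum (f := fun z => (K ^ l) x z * K z x)
        (fun z _ => mul_nonneg (Matrix.pow_apply_nonneg hK l x z) (hK z x)) (Finset.mem_univ x))

end Reversible

/-! ### General Burnside processes: stationarity and symmetry -/

section Burnside

variable (G X : Type*) [Group G] [Fintype G] [Fintype X] [DecidableEq X] [MulAction G X]

theorem burnsideKernel_nonneg (x y : X) : 0 ≤ burnsideKernel G X x y := by
  simp only [burnsideKernel, Matrix.of_apply]
  positivity

/-- After exchanging the sums, each `s` fixing `x` contributes `|X_s|` terms equal to `1 / |X_s|`,
hence 1 in total. -/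
theorem sum_burnsideKernel (x : X) : ∑ y, burnsideKernel G X x y = 1 := by
  have hstab : (Nat.card (MulAction.stabilizer G x) : ℝ)
      = ∑ s : G, if s • x = x then 1 else 0 := by
    rw [Finset.sum_boole, Nat.card_eq_fintype_card, Fintype.card_subtype]
    rfl
  have h0 : (Nat.card (MulAction.stabilizer G x) : ℝ) ≠ 0 := by
    exact_mod_cast Nat.card_pos.ne'
  simp only [burnsideKernel, Matrix.of_apply]
  rw [← Finset.mul_sum, one_div, inv_mul_eq_one₀ h0, hstab]
  simp only [Finset.sum_filter]
  rw [Finset.sum_comm]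
  refine Finset.sum_congr rfl fun s _ => ?_
  by_cases hs : s • x = x
  · have hne : (Nat.card (MulAction.fixedBy X s) : ℝ) ≠ 0 := by
      have : Nonempty (MulAction.fixedBy X s) := ⟨⟨x, hs⟩⟩
      exact_mod_cast Nat.card_pos.ne'
    have hc : (Nat.card (MulAction.fixedBy X s) : ℝ) = ∑ y : X, if s • y = y then 1 else 0 := by
      rw [Finset.sum_boole, Nat.card_eq_fintype_card, Fintype.card_subtype]
      rfl
    simp only [hs, true_and, if_true]
    rw [← Finset.sum_filter, Finset.sum_const, nsmul_eq_mul, mul_one_div, eq_comm,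
      div_eq_one_iff_eq hne, hc, Finset.sum_boole]
  · simp [hs]

theorem burnsideStationary_pos (x : X) : 0 < burnsideStationary G X x := by
  have : Nonempty (MulAction.orbitRel.Quotient G X) := ⟨Quotient.mk'' x⟩
  have h1 : 0 < Nat.card (MulAction.orbitRel.Quotient G X) := Nat.card_pos
  have : Nonempty (MulAction.orbit G x) := ⟨⟨x, MulAction.mem_orbit_self x⟩⟩
  have h2 : 0 < Nat.card (MulAction.orbit G x) := Nat.card_pos
  unfold burnsideStationary
  positivity

/-- By orbit-stabilizer the prefactor becomes `1 / (Z |G|)`, and what remains is symmetric in `x`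
and `y`. -/
theorem burnsideStationary_mul_kernel (x y : X) :
    burnsideStationary G X x * burnsideKernel G X x y
      = burnsideStationary G X y * burnsideKernel G X y x := by
  have key : ∀ x y : X, burnsideStationary G X x * burnsideKernel G X x y
      = 1 / ((Nat.card (MulAction.orbitRel.Quotient G X) : ℝ) * Nat.card G) *
        ∑ s : G with s • x = x ∧ s • y = y, 1 / (Nat.card (MulAction.fixedBy X s) : ℝ) := by
    intro x y
    have h : Nat.card (MulAction.orbit G x) * Nat.card (MulAction.stabilizer G x) = Nat.card G := by
      have : Fintype (MulAction.orbit G x) := Fintype.ofFinite _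
      rw [Nat.card_eq_fintype_card, Nat.card_eq_fintype_card, Nat.card_eq_fintype_card,
        MulAction.card_orbit_mul_card_stabilizer_eq_card_group]
    rw [← h]
    simp only [burnsideKernel, burnsideStationary, Matrix.of_apply]
    push_cast
    rw [← mul_assoc, one_div_mul_one_div, mul_assoc (Nat.card _ : ℝ)]
  rw [key, key]
  simp only [and_comm]

open scoped Classical in
theorem sum_orbit_burnsideStationary (x : X) :
    ∑ y : X with y ∈ MulAction.orbit G x, burnsideStationary G X y
      = 1 / (Nat.card (MulAction.orbitRel.Quotient G X) : ℝ) := by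
  have : Nonempty (MulAction.orbit G x) := ⟨⟨x, MulAction.mem_orbit_self x⟩⟩
  have h2 : (Nat.card (MulAction.orbit G x) : ℝ) ≠ 0 := by exact_mod_cast Nat.card_pos.ne'
  have : ∀ y ∈ ({y : X | y ∈ MulAction.orbit G x} : Finset X), burnsideStationary G X y
      = burnsideStationary G X x := by
    intro y hy
    rw [Finset.mem_filter_univ] at hy
    simp only [burnsideStationary]
    rw [MulAction.orbit_eq_iff.2 hy]
  rw [Finset.sum_congr rfl this, Finset.sum_const, nsmul_eq_mul, burnsideStationary]
  have hc : (({y : X | y ∈ MulAction.orbit G x} : Finset X).card : ℝ)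
      = Nat.card (MulAction.orbit G x) := by
    rw [← Fintype.card_subtype, ← Nat.card_eq_fintype_card]
  rw [hc]
  field_simp

theorem sum_burnsideStationary [Nonempty X] : ∑ x, burnsideStationary G X x = 1 := by
  classical
  have : Nonempty (MulAction.orbitRel.Quotient G X) := Nonempty.map Quotient.mk'' inferInstance
  have h1 : (Nat.card (MulAction.orbitRel.Quotient G X) : ℝ) ≠ 0 := by
    exact_mod_cast Nat.card_pos.ne'
  have : Fintype (MulAction.orbitRel.Quotient G X) := Fintype.ofFinite _
  rw [← Finset.sum_fiberwise (s := Finset.univ)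
    (g := fun x : X => (Quotient.mk'' x : MulAction.orbitRel.Quotient G X))]
  have : ∀ ω : MulAction.orbitRel.Quotient G X,
      ∑ x : X with (Quotient.mk'' x : MulAction.orbitRel.Quotient G X) = ω,
        burnsideStationary G X x = 1 / (Nat.card (MulAction.orbitRel.Quotient G X) : ℝ) := by
    intro ω
    induction ω using Quotient.inductionOn' with
    | h a =>
      rw [← sum_orbit_burnsideStationary G X a]
      refine Finset.sum_congr (Finset.filter_congr fun y _ => ?_) fun _ _ => rfl
      rw [Quotient.eq'']
      exact MulAction.orbitRel_apply
  rw [Finset.sum_congr rfl fun ω _ => this ω, Finset.sum_const, nsmul_eq_mul, Finset.card_univ,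
    ← Nat.card_eq_fintype_card, mul_one_div, div_self h1]

/-- Conjugation by `g` matches the stabilizers and preserves the number of fixed points. -/
theorem burnsideKernel_smul (g : G) (x y : X) :
    burnsideKernel G X (g • x) (g • y) = burnsideKernel G X x y := by
  simp only [burnsideKernel, Matrix.of_apply]
  rw [Nat.card_congr (MulAction.stabilizerEquivStabilizer
    (show g • x = g • x from rfl)).symm.toEquiv]
  congr 1
  symm
  refine Finset.sum_equiv (MulAut.conj g).toEquiv ?_ ?_
  · intro s
    simp [mul_smul]
  · intro s _
    congr 2
    refine Nat.card_congr ((MulAction.toPerm g).subtypeEquiv fun z => ?_)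
    simp [MulAction.mem_fixedBy, mul_smul]

theorem burnsideStationary_smul (g : G) (x : X) :
    burnsideStationary G X (g • x) = burnsideStationary G X x := by
  simp only [burnsideStationary, MulAction.orbit_smul]

theorem burnsideKernel_pow_smul (g : G) (l : ℕ) (x y : X) :
    (burnsideKernel G X ^ l) (g • x) (g • y) = (burnsideKernel G X ^ l) x y := by
  induction l generalizing y with
  | zero => simp [Matrix.one_apply]
  | succ l ih =>
    rw [pow_succ, Matrix.mul_apply, Matrix.mul_apply]
    refine (Fintype.sum_equiv (MulAction.toPerm g) _ _ fun z => ?_).symm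
    rw [MulAction.toPerm_apply, ih, burnsideKernel_smul]

theorem chiSqDist_burnside_smul (g : G) (l : ℕ) (x : X) :
    chiSqDist (burnsideKernel G X) (burnsideStationary G X) l (g • x)
      = chiSqDist (burnsideKernel G X) (burnsideStationary G X) l x := by
  refine (Fintype.sum_equiv (MulAction.toPerm g) _ _ fun z => ?_).symm
  rw [MulAction.toPerm_apply, burnsideKernel_pow_smul, burnsideStationary_smul]

/-- The chi-square distance from any point is controlled by the average one. -/
theorem chiSqDist_burnside_le [Nonempty X] (l : ℕ) (x : X) :
    chiSqDist (burnsideKernel G X) (burnsideStationary G X) l x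
      ≤ Nat.card (MulAction.orbitRel.Quotient G X) *
        ∑ y, burnsideStationary G X y *
          chiSqDist (burnsideKernel G X) (burnsideStationary G X) l y := by
  classical
  have : Nonempty (MulAction.orbitRel.Quotient G X) := Nonempty.map Quotient.mk'' inferInstance
  have h1 : (Nat.card (MulAction.orbitRel.Quotient G X) : ℝ) ≠ 0 := by
    exact_mod_cast Nat.card_pos.ne'
  have h : ∑ y : X with y ∈ MulAction.orbit G x, burnsideStationary G X y *
        chiSqDist (burnsideKernel G X) (burnsideStationary G X) l y
      = 1 / (Nat.card (MulAction.orbitRel.Quotient G X) : ℝ) *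
        chiSqDist (burnsideKernel G X) (burnsideStationary G X) l x := by
    rw [← sum_orbit_burnsideStationary G X x, Finset.sum_mul]
    refine Finset.sum_congr rfl fun y hy => ?_
    rw [Finset.mem_filter_univ] at hy
    obtain ⟨g, rfl⟩ := hy
    congr 1
    exact chiSqDist_burnside_smul G X g l x
  calc _ = (Nat.card (MulAction.orbitRel.Quotient G X) : ℝ) *
        (1 / (Nat.card (MulAction.orbitRel.Quotient G X) : ℝ) *
        chiSqDist (burnsideKernel G X) (burnsideStationary G X) l x) := by field_simp
    _ ≤ _ := by
      rw [← h]
      refine mul_le_mul_of_nonneg_left ?_ (Nat.cast_nonneg _)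
      exact Finset.sum_le_sum_of_subset_of_nonneg (Finset.subset_univ _) fun y _ _ =>
        mul_nonneg (burnsideStationary_pos G X y).le
          (chiSqDist_nonneg (burnsideStationary_pos G X) l y)

end Burnside

/-! ### Summing reciprocal fixed-point counts over permutations -/

section CycleSum

/-- The number of binary labellings invariant under a permutation. -/
noncomputable def invariantCount {α : Type*} (σ : Equiv.Perm α) : ℕ :=
  Nat.card {f : α → Fin 2 // f ∘ σ = f}

/-- The sum of `1 / |X_σ|` over all permutations `σ` of `α`, where `X_σ` is the set of
`σ`-invariant binary labellings. -/
noncomputable def invariantCountSum (α : Type*) [Fintype α] [DecidableEq α] : ℝ :=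
  ∑ σ : Equiv.Perm α, 1 / (invariantCount σ : ℝ)

theorem invariantCount_permCongr {α β : Type*} (e : α ≃ β) (σ : Equiv.Perm α) :
    invariantCount (e.permCongr σ) = invariantCount σ := by
  refine Nat.card_congr ((e.arrowCongr (Equiv.refl (Fin 2))).subtypeEquiv fun f => ?_).symm
  constructor
  · intro h
    ext b
    have := congrFun h (e.symm b)
    simp_all [Equiv.permCongr_apply]
  · intro h
    ext a
    have := congrFun h (e a)
    simp_all [Equiv.permCongr_apply]

theorem invariantCountSum_congr {α β : Type*} [Fintype α] [DecidableEq α] [Fintype β]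
    [DecidableEq β] (e : α ≃ β) : invariantCountSum α = invariantCountSum β :=
  Fintype.sum_equiv e.permCongr _ _ fun σ => by rw [invariantCount_permCongr]

/-- The point `none` is a new cycle of length one, so it carries a free bit. -/
theorem invariantCount_optionCongr {α : Type*} [Finite α] (τ : Equiv.Perm α) :
    invariantCount τ.optionCongr = 2 * invariantCount τ := by
  have e : {f : Option α → Fin 2 // f ∘ τ.optionCongr = f} ≃
      Fin 2 × {f : α → Fin 2 // f ∘ τ = f} :=
    { toFun f := (f.1 none, ⟨fun a => f.1 (some a), by
        ext a
        exact congrArg _ (congrFun f.2 (some a))⟩)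
      invFun p := ⟨fun o => o.elim p.1 p.2.1, by
        ext o
        cases o with
        | none => simp
        | some a => exact congrArg _ (congrFun p.2.2 a)⟩
      left_inv f := by
        ext o
        cases o <;> rfl
      right_inv p := rfl }
  rw [invariantCount, Nat.card_congr e, Nat.card_prod, Nat.card_eq_fintype_card, Fintype.card_fin,
    invariantCount]

/-- The product with the transposition inserts `none` into the cycle of `a`, just before `a`; no new
cycle arises, so the label of `none` is forced. -/
theorem comp_swap_mul_optionCongr_eq_iff {α β : Type*} [DecidableEq α] (τ : Equiv.Perm α) (a : α)
    (f : Option α → β) :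
    f ∘ (Equiv.swap none (some a) * τ.optionCongr : Equiv.Perm (Option α)) = f ↔
      f none = f (some a) ∧ (fun b => f (some b)) ∘ τ = fun b => f (some b) := by
  constructor
  · intro h
    have h0 := congrFun h none
    have h0' : f none = f (some a) := by simpa using h0.symm
    refine ⟨h0', ?_⟩
    ext b
    have h1 := congrFun h (some b)
    by_cases hb : τ b = a
    · simp [hb] at h1
      simp [hb, ← h1, h0']
    · simpa [Equiv.swap_apply_of_ne_of_ne, hb] using h1
  · rintro ⟨h0, h1⟩
    ext o
    cases o with
    | none => simp [h0]
    | some b =>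
      have h2 := congrFun h1 b
      by_cases hb : τ b = a
      · simp [hb] at h2
        simp [hb, h0, h2]
      · simpa [Equiv.swap_apply_of_ne_of_ne, hb] using h2

theorem invariantCount_swap_mul_optionCongr {α : Type*} [DecidableEq α] (τ : Equiv.Perm α) (a : α) :
    invariantCount (Equiv.swap none (some a) * τ.optionCongr : Equiv.Perm (Option α))
      = invariantCount τ := by
  refine Nat.card_congr
    { toFun f := ⟨fun b => f.1 (some b), ((comp_swap_mul_optionCongr_eq_iff τ a f.1).1 f.2).2⟩
      invFun g := ⟨fun o => o.elim (g.1 a) g.1,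
        (comp_swap_mul_optionCongr_eq_iff τ a _).2 ⟨rfl, g.2⟩⟩
      left_inv f := ?_
      right_inv g := rfl }
  ext o
  cases o with
  | none => exact congrArg _ ((comp_swap_mul_optionCongr_eq_iff τ a f.1).1 f.2).1.symm
  | some b => rfl

/-- A new point either enters an existing cycle, in `card α` ways of weight 1, or forms its own
cycle, with weight 1/2. -/
theorem invariantCountSum_option (α : Type*) [Fintype α] [DecidableEq α] :
    invariantCountSum (Option α) = (Fintype.card α + 1 / 2) * invariantCountSum α := by
  rw [invariantCountSum, Fintype.sum_equiv Equiv.Perm.decomposeOption _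
    (fun p : Option α × Equiv.Perm α =>
      1 / (invariantCount (Equiv.Perm.decomposeOption.symm p) : ℝ)) (fun σ => by simp),
    Fintype.sum_prod_type, Fintype.sum_option]
  simp only [Equiv.Perm.decomposeOption_symm_apply, invariantCount_swap_mul_optionCongr,
    Equiv.swap_self]
  have : ∀ τ : Equiv.Perm α, (1 : ℝ) / (invariantCount
      ((Equiv.refl (Option α) : Equiv.Perm (Option α)) * τ.optionCongr) : ℝ)
      = 1 / 2 * (1 / (invariantCount τ : ℝ)) := by
    intro τ
    rw [← Equiv.Perm.one_def, one_mul, invariantCount_optionCongr]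
    push_cast
    rw [one_div_mul_one_div]
  simp only [this, ← Finset.mul_sum, Finset.sum_const, Finset.card_univ, nsmul_eq_mul]
  rw [← invariantCountSum]
  ring

/-- The rising factorial `(1/2)(3/2)⋯(k - 1/2)`. -/
noncomputable def halfRising (k : ℕ) : ℝ := ∏ j ∈ Finset.range k, ((j : ℝ) + 1 / 2)

@[simp] theorem halfRising_zero : halfRising 0 = 1 := by simp [halfRising]

theorem halfRising_succ (k : ℕ) : halfRising (k + 1) = halfRising k * (k + 1 / 2) := by
  rw [halfRising, Finset.prod_range_succ, halfRising]

theorem halfRising_pos (k : ℕ) : 0 < halfRising k :=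
  Finset.prod_pos fun j _ => by positivity

theorem invariantCountSum_eq_halfRising (α : Type*) [Fintype α] [DecidableEq α] :
    invariantCountSum α = halfRising (Fintype.card α) := by
  have key : ∀ k : ℕ, invariantCountSum (Fin k) = halfRising k := by
    intro k
    induction k with
    | zero => simp [invariantCountSum, invariantCount]
    | succ k ih =>
      rw [invariantCountSum_congr (finSuccEquiv k), invariantCountSum_option, ih, halfRising_succ,
        Fintype.card_fin, mul_comm]
  rw [invariantCountSum_congr (Fintype.equivFin α), key]

theorem invariantCount_sigmaCongrRight {ι : Type*} [Fintype ι] {A : ι → Type*}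
    (g : ∀ i, Equiv.Perm (A i)) :
    invariantCount (Equiv.sigmaCongrRight g : Equiv.Perm (Σ i, A i))
      = ∏ i, invariantCount (g i) := by
  simp only [invariantCount]
  rw [← Nat.card_pi]
  refine Nat.card_congr
    { toFun f i := ⟨fun a => f.1 ⟨i, a⟩, by
        ext a
        exact congrArg _ (congrFun f.2 ⟨i, a⟩)⟩
      invFun f := ⟨fun p => (f p.1).1 p.2, by
        ext ⟨i, a⟩
        exact congrArg _ (congrFun (f i).2 a)⟩
      left_inv f := rfl
      right_inv f := rfl }

/-- The sum of `1 / |X_σ|` over the permutations preserving a labelling `c` factors over the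
classes of `c`. -/
theorem sum_stabilizer_invariantCount {α ι : Type*} [Fintype α] [DecidableEq α] [Fintype ι]
    [DecidableEq ι] (c : α → ι) :
    ∑ σ ∈ Finset.univ.filter (fun σ : Equiv.Perm α => c ∘ σ = c), 1 / (invariantCount σ : ℝ)
      = ∏ i, halfRising (Fintype.card {a // c a = i}) := by
  simp only [← invariantCountSum_eq_halfRising, invariantCountSum]
  rw [Finset.prod_univ_sum, Fintype.piFinset_univ]
  symm
  let e : (Σ i, {a // c a = i}) ≃ α := Equiv.sigmaFiberEquiv c
  -- A permutation preserves `c` exactly when it is a family of permutations of the fibres.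
  refine Finset.sum_bij (fun g _ => e.permCongr (Equiv.sigmaCongrRight g)) ?_ ?_ ?_ ?_
  · intro g _
    rw [Finset.mem_filter_univ]
    ext a
    exact (g (c a) ⟨a, rfl⟩).2
  · intro g _ g' _ h
    exact Equiv.Perm.sigmaCongrRightHom_injective (e.permCongr.injective h)
  · intro σ hσ
    rw [Finset.mem_filter_univ] at hσ
    refine ⟨fun i => σ.subtypePerm fun a => by rw [← Function.comp_apply (f := c), hσ],
      Finset.mem_univ _, ?_⟩
    ext a
    rfl
  · intro g _
    rw [invariantCount_permCongr, invariantCount_sigmaCongrRight]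
    push_cast
    simp

end CycleSum

/-! ### Explicit kernel and orbits on binary tuples -/

section KernelFormula

/-- The number of coordinates where `(x, y)` takes the value `(a, b)`. -/
def pairCount {n : ℕ} (x y : BinaryTuple n) (a b : Fin 2) : ℕ :=
  Fintype.card {t // (x t, y t) = (a, b)}

/-- The number of coordinates where `x` takes the value `a`. -/
def valueCount {n : ℕ} (x : BinaryTuple n) (a : Fin 2) : ℕ := Fintype.card {t // x t = a}

theorem card_stabilizer_coordPerm {n : ℕ} (x : BinaryTuple n) :
    Nat.card (MulAction.stabilizer (CoordPerm n) x)
      = (valueCount x 0).factorial * (valueCount x 1).factorial := by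
  rw [Nat.card_congr MulOpposite.opEquiv, Nat.card_congr (DomMulAct.stabilizerMulEquiv x).toEquiv,
    Nat.card_pi, Fin.prod_univ_two, Nat.card_eq_fintype_card, Nat.card_eq_fintype_card,
    Fintype.card_perm, Fintype.card_perm]
  rfl

theorem burnsideKernel_coordPerm {n : ℕ} (x y : BinaryTuple n) :
    burnsideKernel (CoordPerm n) (BinaryTuple n) x y
      = halfRising (pairCount x y 0 0) * halfRising (pairCount x y 0 1) *
          (halfRising (pairCount x y 1 0) * halfRising (pairCount x y 1 1)) /
        ((valueCount x 0).factorial * (valueCount x 1).factorial) := by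
  have h := sum_stabilizer_invariantCount (fun t => (x t, y t))
  rw [Fintype.prod_prod_type, Fin.prod_univ_two, Fin.prod_univ_two, Fin.prod_univ_two] at h
  simp only [burnsideKernel, Matrix.of_apply]
  rw [card_stabilizer_coordPerm, one_div_mul_eq_div]
  push_cast
  congr 1
  refine Eq.trans ?_ h
  refine Finset.sum_equiv DomMulAct.mk.symm ?_ ?_
  · intro s
    simp only [Finset.mem_filter_univ, funext_iff, Function.comp_apply, Prod.mk.injEq,
      DomMulAct.smul_apply, Equiv.Perm.smul_def, forall_and]
  · intro s _
    rfl

theorem pairCount_add {n : ℕ} (x y : BinaryTuple n) (a : Fin 2) :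
    pairCount x y a 0 + pairCount x y a 1 = valueCount x a := by
  simp only [pairCount, valueCount, Fintype.card_subtype, Prod.mk.injEq]
  rw [← Finset.card_union_of_disjoint, ← Finset.filter_or]
  · congr 1
    ext t
    have : y t = 0 ∨ y t = 1 := by omega
    simp only [Finset.mem_filter_univ]
    tauto
  · rw [Finset.disjoint_filter]
    rintro t - ⟨-, h⟩ ⟨-, h'⟩
    rw [h] at h'
    exact absurd h' (by decide)

theorem valueCount_add {n : ℕ} (x : BinaryTuple n) : valueCount x 0 + valueCount x 1 = n := by
  have h := Fintype.card_congr (Equiv.sigmaFiberEquiv x)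
  rw [Fintype.card_sigma, Fin.sum_univ_two, Fintype.card_fin] at h
  exact h

/-- Two binary tuples with the same number of ones are in the same orbit. -/
theorem mem_orbit_of_valueCount_eq {n : ℕ} {x y : BinaryTuple n}
    (h : valueCount x 1 = valueCount y 1) : x ∈ MulAction.orbit (CoordPerm n) y := by
  have h0 : valueCount x 0 = valueCount y 0 := by
    have := valueCount_add x
    have := valueCount_add y
    omega
  have h' : ∀ c : Fin 2, Nonempty ({t // x t = c} ≃ {t // y t = c}) := by
    intro c
    refine Fintype.card_eq.1 ?_
    fin_cases c
    · exact h0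
    · exact h
  refine ⟨DomMulAct.mk (Equiv.ofFiberEquiv fun c => (h' c).some), ?_⟩
  ext t
  simp only [DomMulAct.smul_apply, Equiv.symm_apply_apply, Equiv.Perm.smul_def]
  exact congrArg _ (Equiv.ofFiberEquiv_map _ t)

theorem card_orbits_le (n : ℕ) :
    Nat.card (MulAction.orbitRel.Quotient (CoordPerm n) (BinaryTuple n)) ≤ n + 1 := by
  have hlt : ∀ x : BinaryTuple n, valueCount x 1 < n + 1 := by
    intro x
    have := valueCount_add x
    omega
  have h := Nat.card_le_card_of_injective
    (fun ω : MulAction.orbitRel.Quotient (CoordPerm n) (BinaryTuple n) =>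
      (⟨valueCount ω.out 1, hlt _⟩ : Fin (n + 1))) (by
        intro ω ω' h
        have h1 := mem_orbit_of_valueCount_eq (Fin.mk.inj h)
        rw [← Quotient.out_eq ω, ← Quotient.out_eq ω']
        exact Quotient.sound h1)
  simpa using h

theorem card_orbit_coordPerm {n : ℕ} (x : BinaryTuple n) :
    Nat.card (MulAction.orbit (CoordPerm n) x) = n.choose (valueCount x 0) := by
  have : Fintype (MulAction.orbit (CoordPerm n) x) := Fintype.ofFinite _
  have h : Nat.card (MulAction.orbit (CoordPerm n) x) *
      Nat.card (MulAction.stabilizer (CoordPerm n) x) = n.factorial := by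
    rw [Nat.card_eq_fintype_card, Nat.card_eq_fintype_card,
      MulAction.card_orbit_mul_card_stabilizer_eq_card_group,
      Fintype.card_congr DomMulAct.mk.symm, Fintype.card_perm, Fintype.card_fin]
  have hx := valueCount_add x
  have h2 := Nat.choose_mul_factorial_mul_factorial (show valueCount x 0 ≤ n by omega)
  rw [show n - valueCount x 0 = valueCount x 1 by omega] at h2
  rw [card_stabilizer_coordPerm] at h
  refine Nat.eq_of_mul_eq_mul_right
    (Nat.mul_pos (Nat.factorial_pos (valueCount x 0)) (Nat.factorial_pos (valueCount x 1))) ?_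
  rw [h, ← h2, mul_assoc]

end KernelFormula

/-! ### Traces of powers and triangular matrices -/

section TracePower

theorem Matrix.mul_pow_comm {m n : Type*} [Fintype m] [Fintype n] [DecidableEq m] [DecidableEq n]
    (A : Matrix m n ℝ) (B : Matrix n m ℝ) (l : ℕ) : (A * B) ^ l * A = A * (B * A) ^ l := by
  induction l with
  | zero => simp
  | succ l ih =>
    calc (A * B) ^ (l + 1) * A = (A * B) ^ l * A * (B * A) := by
          simp only [pow_succ, Matrix.mul_assoc]
      _ = A * (B * A) ^ (l + 1) := by rw [ih, pow_succ, Matrix.mul_assoc]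

theorem Matrix.trace_mul_pow_comm {m n : Type*} [Fintype m] [Fintype n] [DecidableEq m]
    [DecidableEq n] (A : Matrix m n ℝ) (B : Matrix n m ℝ) {l : ℕ} (hl : 1 ≤ l) :
    ((A * B) ^ l).trace = ((B * A) ^ l).trace := by
  obtain ⟨l, rfl⟩ := Nat.exists_eq_add_of_le' hl
  rw [pow_succ, ← Matrix.mul_assoc, Matrix.mul_pow_comm, Matrix.mul_assoc, Matrix.trace_mul_comm,
    Matrix.mul_assoc, ← pow_succ]

theorem Matrix.triangular_pow {ι : Type*} [Fintype ι] [DecidableEq ι] [PartialOrder ι]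
    {T : Matrix ι ι ℝ} (hT : ∀ i j, ¬ i ≤ j → T i j = 0) (l : ℕ) :
    (∀ i j, ¬ i ≤ j → (T ^ l) i j = 0) ∧ ∀ i, (T ^ l) i i = T i i ^ l := by
  induction l with
  | zero =>
    refine ⟨fun i j h => ?_, fun i => by simp⟩
    rw [pow_zero, Matrix.one_apply_ne (fun e => h e.le)]
  | succ l ih =>
    refine ⟨fun i j h => ?_, fun i => ?_⟩
    · rw [pow_succ, Matrix.mul_apply]
      refine Finset.sum_eq_zero fun k _ => ?_
      by_cases hik : i ≤ k
      · rw [hT k j (fun hkj => h (hik.trans hkj)), mul_zero]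
      · rw [ih.1 i k hik, zero_mul]
    · rw [pow_succ, Matrix.mul_apply, Finset.sum_eq_single i, ih.2, pow_succ]
      · intro k _ hk
        by_cases hik : i ≤ k
        · rw [hT k i (fun hki => hk (hki.antisymm hik)), mul_zero]
        · rw [ih.1 i k hik, zero_mul]
      · simp

end TracePower

/-! ### Arcsine variables, Walsh characters and eigenvalues -/

section Moments

open Polynomial TensorProduct

/-- The moments of the arcsine distribution on `[-1, 1]`. -/
noncomputable def arcsineMoment : ℕ → ℝ
  | 0 => 1
  | 1 => 0
  | j + 2 => (j + 1) / (j + 2) * arcsineMoment j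

/-- Expectation of a polynomial under the arcsine distribution on `[-1, 1]`. -/
noncomputable def arcsineExpect : ℝ[X] →ₗ[ℝ] ℝ :=
  (Polynomial.basisMonomials ℝ).constr ℝ arcsineMoment

theorem arcsineExpect_X_pow (j : ℕ) : arcsineExpect (X ^ j) = arcsineMoment j := by
  have := (Polynomial.basisMonomials ℝ).constr_basis ℝ arcsineMoment j
  rw [← Polynomial.monomial_one_right_eq_X_pow]
  exact this

/-- Integration by parts for the arcsine distribution. -/
theorem arcsineExpect_stein (p : ℝ[X]) :
    arcsineExpect ((1 - X ^ 2) * derivative p) = arcsineExpect (X * p) := by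
  induction p using Polynomial.induction_on' with
  | add p q hp hq => rw [derivative_add, mul_add, mul_add, map_add, map_add, hp, hq]
  | monomial k a =>
    have hm : (monomial k a : ℝ[X]) = a • X ^ k := by
      rw [← smul_X_eq_monomial]
    rw [hm, derivative_smul, mul_smul_comm, mul_smul_comm, map_smul, map_smul]
    congr 1
    -- On `X ^ (k + 1)` the identity is the recursion defining the moments; on constants it says
    -- that the first moment is 0.
    cases k with
    | zero =>
      have := arcsineExpect_X_pow 1
      rw [pow_one] at this
      simp [this, arcsineMoment]
    | succ k =>
      have h1 : ((1 - X ^ 2) * derivative (X ^ (k + 1)) : ℝ[X])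
          = ((k : ℝ) + 1) • X ^ k - ((k : ℝ) + 1) • X ^ (k + 2) := by
        rw [derivative_X_pow, smul_eq_C_mul, smul_eq_C_mul, Nat.add_sub_cancel]
        push_cast
        ring
      have h2 : (X * X ^ (k + 1) : ℝ[X]) = X ^ (k + 2) := by ring
      rw [h1, h2, map_sub, map_smul, map_smul, arcsineExpect_X_pow, arcsineExpect_X_pow,
        arcsineMoment, smul_eq_mul, smul_eq_mul]
      field_simp
      ring

/-- The Stein identity closes up here because `1 - X ^ 2 = (1 + X) * (1 - X)` clears the logarithmic
derivative of the product. -/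
theorem arcsineExpect_mul_X (a b : ℕ) :
    ((a : ℝ) + b + 1) * arcsineExpect ((1 + X) ^ a * (1 - X) ^ b * X)
      = (a - b) * arcsineExpect ((1 + X) ^ a * (1 - X) ^ b) := by
  have h := arcsineExpect_stein ((1 + X) ^ a * (1 - X) ^ b)
  have h1 : ((1 - X ^ 2) * derivative ((1 + X) ^ a * (1 - X) ^ b) : ℝ[X])
      = ((a : ℝ) - b) • ((1 + X) ^ a * (1 - X) ^ b)
        - ((a : ℝ) + b) • ((1 + X) ^ a * (1 - X) ^ b * X) := by
    have ha : ((1 + X) * derivative ((1 + X) ^ a) : ℝ[X]) = C (a : ℝ) * (1 + X) ^ a := by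
      cases a with
      | zero => simp
      | succ a => simp [derivative_pow]; ring
    have hb : ((1 - X) * derivative ((1 - X) ^ b) : ℝ[X]) = - C (b : ℝ) * (1 - X) ^ b := by
      cases b with
      | zero => simp
      | succ b => simp [derivative_pow]; ring
    rw [derivative_mul, smul_eq_C_mul, smul_eq_C_mul, C_sub, C_add]
    linear_combination (1 - X) * (1 - X) ^ b * ha + (1 + X) * (1 + X) ^ a * hb
  rw [h1, map_sub, map_smul, map_smul, smul_eq_mul, smul_eq_mul, mul_comm X] at h
  linear_combination -h

/-- The arcsine law in the Bernoulli parameter is the `Beta(1/2, 1/2)` law. -/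
theorem arcsineExpect_one_add_mul_one_sub (a b : ℕ) :
    arcsineExpect ((1 + X) ^ a * (1 - X) ^ b)
      = 2 ^ (a + b) * (halfRising a * halfRising b) / (a + b).factorial := by
  -- By `arcsineExpect_mul_X`, an extra factor `1 + X` multiplies the expectation by `(2a + 1) / (a
  -- + b + 1)`, and symmetrically for `1 - X`.
  induction a with
  | zero =>
    induction b with
    | zero => simpa [arcsineMoment] using arcsineExpect_X_pow 0
    | succ b ih =>
      have h := arcsineExpect_mul_X 0 b
      have h1 : ((1 + X) ^ 0 * (1 - X) ^ (b + 1) : ℝ[X])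
          = (1 + X) ^ 0 * (1 - X) ^ b - (1 + X) ^ 0 * (1 - X) ^ b * X := by ring
      rw [h1, map_sub, ← add_assoc, Nat.factorial_succ, halfRising_succ, pow_succ]
      rw [ih] at h ⊢
      have h2 : ((0 + b).factorial : ℝ) ≠ 0 := by positivity
      have h3 : ((0 : ℕ) : ℝ) + b + 1 ≠ 0 := by positivity
      rw [mul_comm, ← eq_div_iff h3] at h
      rw [h]
      push_cast
      field_simp
      ring
  | succ a ih =>
    have h := arcsineExpect_mul_X a b
    have h1 : ((1 + X) ^ (a + 1) * (1 - X) ^ b : ℝ[X])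
        = (1 + X) ^ a * (1 - X) ^ b + (1 + X) ^ a * (1 - X) ^ b * X := by ring
    rw [h1, map_add, add_right_comm, Nat.factorial_succ, halfRising_succ, pow_succ]
    have h2 : ((a + b).factorial : ℝ) ≠ 0 := by positivity
    have h3 : (a : ℝ) + b + 1 ≠ 0 := by positivity
    rw [ih] at h ⊢
    rw [mul_comm, ← eq_div_iff h3] at h
    rw [h]
    push_cast
    field_simp
    ring

/-- Expectation of a polynomial in two independent arcsine variables. -/
noncomputable def arcsineExpect₂ : ℝ[X] ⊗[ℝ] ℝ[X] →ₗ[ℝ] ℝ :=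
  LinearMap.mul' ℝ ℝ ∘ₗ TensorProduct.map arcsineExpect arcsineExpect

theorem neg_one_smul_tensor (z : ℝ[X] ⊗[ℝ] ℝ[X]) : (-1 : ℝ) • z = -z :=
  neg_one_smul ℝ z

theorem smul_tensor_eq (c : ℝ) (z : ℝ[X] ⊗[ℝ] ℝ[X]) :
    c • z = algebraMap ℝ (ℝ[X] ⊗[ℝ] ℝ[X]) c * z :=
  Algebra.smul_def c z

/-- The two independent arcsine variables. -/
noncomputable def arcsineVar : Fin 2 → ℝ[X] ⊗[ℝ] ℝ[X] := ![X ⊗ₜ 1, 1 ⊗ₜ X]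

theorem arcsineExpect₂_tmul (p q : ℝ[X]) :
    arcsineExpect₂ (p ⊗ₜ q) = arcsineExpect p * arcsineExpect q := by
  simp [arcsineExpect₂]

theorem arcsineExpect₂_pow_mul_pow (i j : ℕ) :
    arcsineExpect₂ (arcsineVar 0 ^ i * arcsineVar 1 ^ j) = arcsineMoment i * arcsineMoment j := by
  simp [arcsineVar, Algebra.TensorProduct.tmul_pow, Algebra.TensorProduct.tmul_mul_tmul,
    arcsineExpect₂_tmul, arcsineExpect_X_pow]

/-- The sign attached to a bit. -/
def bitSign (b : Fin 2) : ℝ := (-1) ^ (b : ℕ)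

/-- Grouping coordinates by the pair `(x t, y t)` splits the product between the two variables; each
factor is then a Beta moment, and the four match the rising factorials in the kernel. -/
theorem burnsideKernel_eq_arcsineExpect₂ {n : ℕ} (x y : BinaryTuple n) :
    burnsideKernel (CoordPerm n) (BinaryTuple n) x y
      = (1 / 2 ^ n) * arcsineExpect₂ (∏ t, (1 + bitSign (y t) • arcsineVar (x t))) := by
  have h1 : ∏ t, (1 + bitSign (y t) • arcsineVar (x t))
      = ((1 + X) ^ pairCount x y 0 0 * (1 - X) ^ pairCount x y 0 1) ⊗ₜ[ℝ]
        ((1 + X) ^ pairCount x y 1 0 * (1 - X) ^ pairCount x y 1 1) := by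
    have := Finset.prod_fiberwise' Finset.univ (fun t => (x t, y t))
      (fun p : Fin 2 × Fin 2 => 1 + bitSign p.2 • arcsineVar p.1)
    rw [← this]
    simp only [Finset.prod_const, Fintype.prod_prod_type, Fin.prod_univ_two]
    simp only [← Fintype.card_subtype]
    have hu : (1 + X ⊗ₜ 1 : ℝ[X] ⊗[ℝ] ℝ[X]) = (1 + X) ⊗ₜ 1 := by
      rw [TensorProduct.add_tmul, Algebra.TensorProduct.one_def]
    have hv : (1 + 1 ⊗ₜ X : ℝ[X] ⊗[ℝ] ℝ[X]) = 1 ⊗ₜ (1 + X) := by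
      rw [TensorProduct.tmul_add, Algebra.TensorProduct.one_def]
    have hu' : (1 - X ⊗ₜ 1 : ℝ[X] ⊗[ℝ] ℝ[X]) = (1 - X) ⊗ₜ 1 := by
      rw [TensorProduct.sub_tmul, Algebra.TensorProduct.one_def]
    have hv' : (1 - 1 ⊗ₜ X : ℝ[X] ⊗[ℝ] ℝ[X]) = 1 ⊗ₜ (1 - X) := by
      rw [TensorProduct.tmul_sub, Algebra.TensorProduct.one_def]
    simp only [arcsineVar, Matrix.cons_val_zero, Matrix.cons_val_one, bitSign, Fin.val_zero,
      Fin.val_one, pow_zero, pow_one, one_smul, neg_one_smul_tensor, ← sub_eq_add_neg, hu, hv, hu', hv',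
      Algebra.TensorProduct.tmul_pow, Algebra.TensorProduct.tmul_mul_tmul, one_pow, one_mul,
      mul_one]
    rfl
  rw [h1, arcsineExpect₂_tmul, arcsineExpect_one_add_mul_one_sub,
    arcsineExpect_one_add_mul_one_sub, pairCount_add, pairCount_add, burnsideKernel_coordPerm]
  have h2 : (2 : ℝ) ^ n = 2 ^ valueCount x 0 * 2 ^ valueCount x 1 := by
    rw [← pow_add, valueCount_add]
  rw [h2]
  field_simp

theorem sum_fun_prod_eq_prod_sum {R : Type*} [CommRing R] {n : ℕ} (g : Fin n → Fin 2 → R) :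
    ∑ x : BinaryTuple n, ∏ t, g t (x t) = ∏ t, (g t 0 + g t 1) := by
  simp only [← Fin.sum_univ_two]
  rw [Finset.prod_univ_sum, Fintype.piFinset_univ]

/-- Matrix of Walsh characters. -/
noncomputable def walshMatrix (n : ℕ) : Matrix (Finset (Fin n)) (BinaryTuple n) ℝ :=
  Matrix.of fun S x => ∏ t ∈ S, bitSign (x t)

/-- The Burnside kernel applied to Walsh characters, up to the factor `2 ^ n`. -/
noncomputable def walshImage (n : ℕ) : Matrix (BinaryTuple n) (Finset (Fin n)) ℝ :=
  Matrix.of fun x S => (1 / 2 ^ n) * arcsineExpect₂ (∏ t ∈ S, arcsineVar (x t))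

theorem burnsideKernel_eq_mul (n : ℕ) :
    burnsideKernel (CoordPerm n) (BinaryTuple n) = walshImage n * walshMatrix n := by
  ext x y
  rw [burnsideKernel_eq_arcsineExpect₂, Finset.prod_one_add, Finset.powerset_univ, map_sum,
    Finset.mul_sum, Matrix.mul_apply]
  refine Finset.sum_congr rfl fun S _ => ?_
  rw [Finset.prod_smul, map_smul, smul_eq_mul, walshImage, walshMatrix, Matrix.of_apply,
    Matrix.of_apply]
  ring

/-- Summing over `x` coordinate by coordinate turns the matrix product into a single product over
`t`. -/
theorem walshMatrix_mul_walshImage {n : ℕ} (R S : Finset (Fin n)) :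
    (walshMatrix n * walshImage n) R S = (1 / 2 ^ n) * arcsineExpect₂ (∏ t,
      (((if t ∈ R then bitSign 0 else 1) • if t ∈ S then arcsineVar 0 else 1) +
        ((if t ∈ R then bitSign 1 else 1) • if t ∈ S then arcsineVar 1 else 1))) := by
  rw [← sum_fun_prod_eq_prod_sum (fun t b =>
      (if t ∈ R then bitSign b else 1) • if t ∈ S then arcsineVar b else 1),
    map_sum, Finset.mul_sum, Matrix.mul_apply]
  refine Finset.sum_congr rfl fun x _ => ?_
  rw [Finset.prod_smul, map_smul, smul_eq_mul, walshImage, walshMatrix, Matrix.of_apply,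
    Matrix.of_apply, Finset.prod_ite_mem, Finset.prod_ite_mem, Finset.univ_inter,
    Finset.univ_inter]
  ring

/-- A coordinate in `R` but not in `S` contributes the factor `1 + (-1) = 0`. -/
theorem walshMatrix_mul_walshImage_eq_zero {n : ℕ} (R S : Finset (Fin n)) (h : ¬ R ≤ S) :
    (walshMatrix n * walshImage n) R S = 0 := by
  obtain ⟨t, hR, hS⟩ := Finset.not_subset.1 h
  rw [walshMatrix_mul_walshImage, Finset.prod_eq_zero (Finset.mem_univ t), map_zero, mul_zero]
  simp [hR, hS, bitSign, neg_one_smul_tensor]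

/-- The eigenvalue of the binary Burnside process attached to a set of `s` coordinates. -/
noncomputable def walshEigenvalue (s : ℕ) : ℝ :=
  (1 / 2 ^ s) * arcsineExpect₂ ((arcsineVar 0 - arcsineVar 1) ^ s)

theorem walshMatrix_mul_walshImage_diag {n : ℕ} (S : Finset (Fin n)) :
    (walshMatrix n * walshImage n) S S = walshEigenvalue S.card := by
  have h : (∏ t, (((if t ∈ S then bitSign 0 else 1) • if t ∈ S then arcsineVar 0 else 1) +
        ((if t ∈ S then bitSign 1 else 1) • if t ∈ S then arcsineVar 1 else 1)))
      = (2 : ℝ) ^ (n - S.card) • (arcsineVar 0 - arcsineVar 1) ^ S.card := by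
    have h1 : ∀ t, (((if t ∈ S then bitSign 0 else 1) • if t ∈ S then arcsineVar 0 else 1) +
        ((if t ∈ S then bitSign 1 else 1) • if t ∈ S then arcsineVar 1 else 1))
        = if t ∈ S then arcsineVar 0 - arcsineVar 1 else (2 : ℝ) • 1 := by
      intro t
      by_cases ht : t ∈ S
      · simp [ht, bitSign, sub_eq_add_neg, neg_one_smul_tensor]
      · simp [ht, two_smul]
    rw [Finset.prod_congr rfl fun t _ => h1 t, Finset.prod_ite, Finset.prod_const,
      Finset.prod_const, _root_.smul_pow, one_pow, mul_smul_comm, mul_one]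
    congr 2
    · rw [Finset.filter_not, Finset.filter_univ_mem, ← Finset.compl_eq_univ_sdiff,
        Finset.card_compl, Fintype.card_fin]
    · rw [Finset.filter_univ_mem]
  have hS : S.card ≤ n := by simpa using S.card_le_univ
  rw [walshMatrix_mul_walshImage, h, map_smul, smul_eq_mul, walshEigenvalue, ← mul_assoc]
  congr 1
  rw [one_div_mul_eq_div, div_eq_div_iff (by positivity) (by positivity), ← pow_add, one_mul,
    Nat.sub_add_cancel hS]

/-- Swapping the two factors of the kernel gives a triangular matrix whose diagonal depends only on
the size of the set. Positivity of `l` is essential, since the two products have different index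
types. -/
theorem trace_burnsideKernel_pow (n : ℕ) {l : ℕ} (hl : 1 ≤ l) :
    (burnsideKernel (CoordPerm n) (BinaryTuple n) ^ l).trace
      = ∑ s ∈ Finset.range (n + 1), (n.choose s : ℝ) * walshEigenvalue s ^ l := by
  rw [burnsideKernel_eq_mul, Matrix.trace_mul_pow_comm _ _ hl, Matrix.trace]
  simp only [Matrix.diag_apply,
    (Matrix.triangular_pow (fun R S => walshMatrix_mul_walshImage_eq_zero R S) l).2,
    walshMatrix_mul_walshImage_diag]
  have := Finset.sum_powerset_apply_card (fun s => walshEigenvalue s ^ l)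
    (x := (Finset.univ : Finset (Fin n)))
  rw [Finset.powerset_univ, Finset.card_univ, Fintype.card_fin] at this
  rw [this]
  simp only [nsmul_eq_mul]

theorem arcsineMoment_of_odd (k : ℕ) : arcsineMoment (2 * k + 1) = 0 := by
  induction k with
  | zero => rfl
  | succ k ih =>
    rw [show 2 * (k + 1) + 1 = 2 * k + 1 + 2 by ring, arcsineMoment, ih, mul_zero]

theorem arcsineMoment_of_even (k : ℕ) :
    arcsineMoment (2 * k) = ((2 * k).choose k : ℝ) / 4 ^ k := by
  induction k with
  | zero => simp [arcsineMoment]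
  | succ k ih =>
    have h : ((k : ℝ) + 1) * ((2 * (k + 1)).choose (k + 1) : ℝ)
        = 2 * (2 * k + 1) * ((2 * k).choose k : ℝ) := by
      exact_mod_cast Nat.succ_mul_centralBinom_succ k
    rw [show 2 * (k + 1) = 2 * k + 2 by ring, arcsineMoment, ih,
      ← show 2 * (k + 1) = 2 * k + 2 by ring]
    push_cast
    rw [div_mul_div_comm, div_eq_div_iff (by positivity) (by positivity), pow_succ]
    linear_combination (-2 * 4 ^ k) * h

theorem sum_range_of_odd_eq_zero {f : ℕ → ℝ} (hf : ∀ k, f (2 * k + 1) = 0) (n : ℕ) :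
    ∑ s ∈ Finset.range (n + 1), f s = ∑ k ∈ Finset.range (n / 2 + 1), f (2 * k) := by
  induction n with
  | zero => simp
  | succ n ih =>
    rw [Finset.sum_range_succ, ih]
    rcases Nat.even_or_odd' n with ⟨k, rfl | rfl⟩
    · rw [hf, add_zero, show (2 * k + 1) / 2 = 2 * k / 2 by omega]
    · rw [show (2 * k + 1 + 1) / 2 = k + 1 by omega, show (2 * k + 1) / 2 = k by omega,
        Finset.sum_range_succ _ (k + 1)]
      rfl

theorem walshEigenvalue_eq_sum (s : ℕ) : walshEigenvalue s = (1 / 2 ^ s) *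
    ∑ j ∈ Finset.range (s + 1),
      (-1) ^ (j + s) * (s.choose j : ℝ) * (arcsineMoment j * arcsineMoment (s - j)) := by
  rw [walshEigenvalue, sub_pow, map_sum]
  congr 1
  refine Finset.sum_congr rfl fun j _ => ?_
  have h : ((-1) ^ (j + s) * arcsineVar 0 ^ j * arcsineVar 1 ^ (s - j) * (s.choose j))
      = ((-1) ^ (j + s) * (s.choose j : ℝ)) • (arcsineVar 0 ^ j * arcsineVar 1 ^ (s - j)) := by
    rw [smul_tensor_eq, map_mul, map_pow, map_neg, map_one, map_natCast]
    ring
  rw [h, map_smul, smul_eq_mul, arcsineExpect₂_pow_mul_pow]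

theorem walshEigenvalue_of_odd (k : ℕ) : walshEigenvalue (2 * k + 1) = 0 := by
  rw [walshEigenvalue_eq_sum, Finset.sum_eq_zero, mul_zero]
  intro j hj
  rw [Finset.mem_range] at hj
  rcases Nat.even_or_odd' j with ⟨i, rfl | rfl⟩
  · rw [show 2 * k + 1 - 2 * i = 2 * (k - i) + 1 by omega, arcsineMoment_of_odd, mul_zero, mul_zero]
  · rw [arcsineMoment_of_odd, zero_mul, mul_zero]

/-- Both sides equal `(2k)! / (i! (k - i)!)²`. -/
theorem choose_mul_centralBinom_mul_centralBinom {k i : ℕ} (hi : i ≤ k) :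
    (2 * k).choose (2 * i) * ((2 * i).choose i * (2 * (k - i)).choose (k - i))
      = (2 * k).choose k * k.choose i ^ 2 := by
  have h1 := Nat.choose_mul_factorial_mul_factorial (show 2 * i ≤ 2 * k by omega)
  have h2 := Nat.choose_mul_factorial_mul_factorial (show i ≤ 2 * i by omega)
  have h3 := Nat.choose_mul_factorial_mul_factorial (show k - i ≤ 2 * (k - i) by omega)
  have h4 := Nat.choose_mul_factorial_mul_factorial (show k ≤ 2 * k by omega)
  have h5 := Nat.choose_mul_factorial_mul_factorial hi
  rw [show 2 * k - 2 * i = 2 * (k - i) by omega] at h1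
  rw [show 2 * i - i = i by omega] at h2
  rw [show 2 * (k - i) - (k - i) = k - i by omega] at h3
  rw [show 2 * k - k = k by omega] at h4
  have hpos : 0 < (i.factorial * (k - i).factorial) ^ 2 := by positivity
  refine Nat.eq_of_mul_eq_mul_right hpos ?_
  calc _ = (2 * k).choose (2 * i) * ((2 * i).choose i * i.factorial * i.factorial) *
        ((2 * (k - i)).choose (k - i) * (k - i).factorial * (k - i).factorial) := by ring
    _ = (2 * k).choose k * (k.choose i * i.factorial * (k - i).factorial) ^ 2 := by
      rw [h2, h3, h1, h5, ← h4]
      ring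
    _ = _ := by ring

/-- The nontrivial eigenvalues of the binary Burnside process. -/
noncomputable def burnsideEigenvalue (k : ℕ) : ℝ :=
  1 / (2 : ℝ) ^ (4 * k) * ((2 * k).choose k : ℝ) ^ 2

theorem walshEigenvalue_of_even (k : ℕ) : walshEigenvalue (2 * k) = burnsideEigenvalue k := by
  rw [walshEigenvalue_eq_sum, sum_range_of_odd_eq_zero, show 2 * k / 2 = k by omega]
  · have h : ∀ i ∈ Finset.range (k + 1), (-1 : ℝ) ^ (2 * i + 2 * k) * ((2 * k).choose (2 * i) : ℝ) *
        (arcsineMoment (2 * i) * arcsineMoment (2 * k - 2 * i))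
        = ((2 * k).choose k : ℝ) / 4 ^ k * ((k.choose i ^ 2 : ℕ) : ℝ) := by
      intro i hi
      have hi' : i ≤ k := by rw [Finset.mem_range] at hi; omega
      have h1 : (((2 * k).choose (2 * i) : ℝ)) *
          (((2 * i).choose i : ℝ) * ((2 * (k - i)).choose (k - i) : ℝ))
          = ((2 * k).choose k : ℝ) * (k.choose i : ℝ) ^ 2 := by
        exact_mod_cast choose_mul_centralBinom_mul_centralBinom hi'
      have h2 : (4 : ℝ) ^ k = 4 ^ i * 4 ^ (k - i) := by
        rw [← pow_add, Nat.add_sub_cancel' hi']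
      rw [← mul_add, pow_mul, neg_one_sq, one_pow, one_mul,
        show 2 * k - 2 * i = 2 * (k - i) by omega, arcsineMoment_of_even, arcsineMoment_of_even, h2]
      push_cast
      field_simp
      linear_combination h1
    rw [Finset.sum_congr rfl h, ← Finset.mul_sum, ← Nat.cast_sum, Nat.sum_range_choose_sq,
      burnsideEigenvalue]
    have h3 : (2 : ℝ) ^ (4 * k) = 2 ^ (2 * k) * 4 ^ k := by
      rw [show 4 * k = 2 * k + 2 * k by ring, pow_add, pow_mul 2 2 k]
      norm_num
    rw [h3]
    field_simp
  · intro j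
    rw [arcsineMoment_of_odd, zero_mul, mul_zero]

end Moments

/-! ### Bounds on eigenvalues and holding probabilities -/

section Bounds

theorem burnsideEigenvalue_nonneg (k : ℕ) : 0 ≤ burnsideEigenvalue k := by
  unfold burnsideEigenvalue
  positivity

/-- Successive ratios are `((2k+1)/(2k+2))²`, at most `(2k+1)/(2k+3)`, and the latter telescope. -/
theorem burnsideEigenvalue_le (k : ℕ) : burnsideEigenvalue k ≤ 1 / (2 * k + 1) := by
  induction k with
  | zero => simp [burnsideEigenvalue]
  | succ k ih =>
    have h : ((k : ℝ) + 1) * ((2 * (k + 1)).choose (k + 1) : ℝ)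
        = 2 * (2 * k + 1) * ((2 * k).choose k : ℝ) := by
      exact_mod_cast Nat.succ_mul_centralBinom_succ k
    have h1 : burnsideEigenvalue (k + 1)
        = (2 * k + 1) ^ 2 / (2 * k + 2) ^ 2 * burnsideEigenvalue k := by
      rw [mul_comm, ← eq_div_iff (by positivity)] at h
      rw [burnsideEigenvalue, h, burnsideEigenvalue, mul_add, pow_add]
      field_simp
    rw [h1]
    refine (mul_le_mul_of_nonneg_left ih (by positivity)).trans ?_
    rw [div_mul_div_comm, div_le_div_iff₀ (by positivity) (by positivity)]
    push_cast
    nlinarith [(Nat.cast_nonneg k : (0 : ℝ) ≤ k), sq_nonneg ((k : ℝ))]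

theorem one_div_succ_le_halfRising_div (k : ℕ) :
    1 / ((k : ℝ) + 1) ≤ halfRising k / k.factorial := by
  induction k with
  | zero => simp
  | succ k ih =>
    have h : halfRising (k + 1) / (k + 1).factorial
        = halfRising k / k.factorial * ((k + 1 / 2) / (k + 1)) := by
      rw [halfRising_succ, Nat.factorial_succ]
      push_cast
      field_simp
    rw [h]
    refine le_trans ?_ (mul_le_mul_of_nonneg_right ih (by positivity))
    rw [div_mul_div_comm, div_le_div_iff₀ (by positivity) (by positivity)]
    push_cast
    nlinarith [(Nat.cast_nonneg k : (0 : ℝ) ≤ k)]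

theorem le_burnsideKernel_self {n : ℕ} (hn : 2 ≤ n) (x : BinaryTuple n) :
    1 / (n : ℝ) ^ 2 ≤ burnsideKernel (CoordPerm n) (BinaryTuple n) x x := by
  have h01 : pairCount x x 0 1 = 0 := by
    rw [pairCount, Fintype.card_eq_zero_iff]
    refine ⟨fun t => ?_⟩
    obtain ⟨h1, h2⟩ := Prod.mk.inj t.2
    exact absurd (h1.symm.trans h2) (by decide)
  have h10 : pairCount x x 1 0 = 0 := by
    rw [pairCount, Fintype.card_eq_zero_iff]
    refine ⟨fun t => ?_⟩
    obtain ⟨h1, h2⟩ := Prod.mk.inj t.2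
    exact absurd (h1.symm.trans h2) (by decide)
  have h00 := pairCount_add x x 0
  have h11 := pairCount_add x x 1
  rw [h01, add_zero] at h00
  rw [h10, zero_add] at h11
  rw [burnsideKernel_coordPerm, h01, h10, h00, h11, halfRising_zero, mul_one, one_mul,
    ← div_mul_div_comm]
  refine le_trans ?_ (mul_le_mul (one_div_succ_le_halfRising_div _)
    (one_div_succ_le_halfRising_div _) (by positivity)
    (div_nonneg (halfRising_pos _).le (Nat.cast_nonneg _)))
  have hs : (valueCount x 0 : ℝ) + valueCount x 1 = n := by exact_mod_cast valueCount_add x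
  have hn' : (2 : ℝ) ≤ n := by exact_mod_cast hn
  rw [one_div_mul_one_div]
  refine one_div_le_one_div_of_le (by positivity) ?_
  -- AM-GM bounds the denominator by `(n/2 + 1)²`, which is at most `n²` once `n ≥ 2`.
  nlinarith [sq_nonneg ((valueCount x 0 : ℝ) - valueCount x 1)]

theorem valueCount_halfState (n : ℕ) : valueCount (halfState n) 0 = n / 2 := by
  have h : ∀ t : Fin n, halfState n t = 0 ↔ (t : ℕ) < n / 2 := by
    intro t
    unfold halfState
    split_ifs with h <;> simp [h]
  rw [valueCount, Fintype.card_subtype]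
  simp only [h]
  rw [Fin.card_filter_val_lt]
  omega

end Bounds

/-! ### Exact formula and the two asymptotic regimes -/

section ChiSquare

theorem binaryChiSqAvg_eq_trace (n l : ℕ) : binaryChiSqAvg n l =
    (burnsideKernel (CoordPerm n) (BinaryTuple n) ^ (2 * l)).trace - 1 :=
  sum_mul_chiSqDist (burnsideStationary_pos _ _) (sum_burnsideStationary _ _)
    (sum_burnsideKernel _ _) (burnsideStationary_mul_kernel _ _) l

theorem binaryChiSq_eq_return (n l : ℕ) (x : BinaryTuple n) : binaryChiSq n l x =
    (burnsideKernel (CoordPerm n) (BinaryTuple n) ^ (2 * l)) x x /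
      burnsideStationary (CoordPerm n) (BinaryTuple n) x - 1 :=
  chiSqDist_eq_return (burnsideStationary_pos _ _) (sum_burnsideStationary _ _)
    (sum_burnsideKernel _ _) (burnsideStationary_mul_kernel _ _) l x

theorem binaryChiSq_nonneg (n l : ℕ) (x : BinaryTuple n) : 0 ≤ binaryChiSq n l x :=
  chiSqDist_nonneg (burnsideStationary_pos _ _) l x

theorem binaryChiSqAvg_nonneg (n l : ℕ) : 0 ≤ binaryChiSqAvg n l :=
  Finset.sum_nonneg fun x _ =>
    mul_nonneg (burnsideStationary_pos _ _ x).le (binaryChiSq_nonneg n l x)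

theorem binaryChiSq_le (n l : ℕ) (x : BinaryTuple n) :
    binaryChiSq n l x ≤ (n + 1) * binaryChiSqAvg n l := by
  refine (chiSqDist_burnside_le (CoordPerm n) (BinaryTuple n) l x).trans ?_
  refine mul_le_mul_of_nonneg_right ?_ (binaryChiSqAvg_nonneg n l)
  exact_mod_cast card_orbits_le n

theorem binaryChiSqAvg_eq (n : ℕ) {l : ℕ} (hl : 1 ≤ l) : binaryChiSqAvg n l =
    ∑ k ∈ Finset.Icc 1 (n / 2), (n.choose (2 * k) : ℝ) * burnsideEigenvalue k ^ (2 * l) := by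
  -- A nonzero exponent is what makes the zero eigenvalues drop out of the sum.
  have hl' : 2 * l ≠ 0 := by omega
  rw [binaryChiSqAvg_eq_trace, trace_burnsideKernel_pow n (by omega), sum_range_of_odd_eq_zero]
  · simp only [walshEigenvalue_of_even]
    -- The term `k = 0` is 1 and cancels the `-1`.
    rw [Finset.range_eq_Ico, Finset.sum_eq_sum_Ico_succ_bot (Nat.succ_pos _)]
    have h : Finset.Ico (0 + 1) (n / 2 + 1) = Finset.Icc 1 (n / 2) := by
      ext k
      simp only [Finset.mem_Ico, Finset.mem_Icc]
      omega
    rw [h]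
    simp [burnsideEigenvalue]
  · intro k
    rw [walshEigenvalue_of_odd, zero_pow hl', mul_zero]

theorem exp_neg_le_return {n l : ℕ} (hn : 2 ≤ n)
    (hl : (l : ℝ) ≤ 0.1 * (n : ℝ) / Real.log (n : ℝ)) (x : BinaryTuple n) :
    Real.exp (-(0.4 * n)) ≤ (burnsideKernel (CoordPerm n) (BinaryTuple n) ^ (2 * l)) x x := by
  have hn0 : (0 : ℝ) < n := by positivity
  have hlog : 0 < Real.log n := Real.log_pos (by exact_mod_cast hn)
  rw [le_div_iff₀ hlog] at hl
  refine le_trans ?_ (Matrix.pow_diag_le_pow_apply (burnsideKernel_nonneg _ _) (2 * l) x)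
  refine le_trans ?_ (pow_le_pow_left₀ (by positivity) (le_burnsideKernel_self hn x) (2 * l))
  have h : 1 / (n : ℝ) ^ 2 = Real.exp (-(2 * Real.log n)) := by
    rw [Real.exp_neg, two_mul, Real.exp_add, Real.exp_log hn0, one_div, sq]
  rw [h, ← Real.exp_nat_mul, Real.exp_le_exp]
  push_cast
  linarith

theorem binaryChiSq_lower {n l : ℕ} (hn : 2 ≤ n)
    (hl : (l : ℝ) ≤ 0.1 * (n : ℝ) / Real.log (n : ℝ)) :
    2 ^ n / (n + 1) * Real.exp (-(0.4 * n)) - 1 ≤ binaryChiSqAvg n l ∧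
      2 ^ n / (n + 1) * Real.exp (-(0.4 * n)) - 1 ≤ binaryChiSq n l (halfState n) := by
  have hret := exp_neg_le_return hn hl
  constructor
  · rw [binaryChiSqAvg_eq_trace, Matrix.trace]
    have h := Finset.card_nsmul_le_sum (Finset.univ : Finset (BinaryTuple n))
      (fun x => (burnsideKernel (CoordPerm n) (BinaryTuple n) ^ (2 * l)).diag x)
      (Real.exp (-(0.4 * n))) (fun x _ => hret x)
    rw [Finset.card_univ, Fintype.card_fun, Fintype.card_fin, Fintype.card_fin, nsmul_eq_mul] at h
    push_cast at h
    -- The average satisfies the bound even without dividing by `n + 1`; it is weakened to share one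
    -- bound with the half state.
    have h2 : (2 : ℝ) ^ n / (n + 1) ≤ 2 ^ n :=
      div_le_self (by positivity) (by linarith [(Nat.cast_nonneg n : (0 : ℝ) ≤ n)])
    have h3 := mul_le_mul_of_nonneg_right h2 (Real.exp_pos (-(0.4 * (n : ℝ)))).le
    linarith
  · rw [binaryChiSq_eq_return]
    have hZ : (1 : ℝ) ≤ Nat.card (MulAction.orbitRel.Quotient (CoordPerm n) (BinaryTuple n)) := by
      have : Nonempty (MulAction.orbitRel.Quotient (CoordPerm n) (BinaryTuple n)) :=
        ⟨Quotient.mk'' (halfState n)⟩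
      exact_mod_cast Nat.card_pos
    have hC : (2 : ℝ) ^ n ≤ (n + 1) * (n.choose (n / 2) : ℝ) := by
      have h1 : 2 ^ n ≤ (n + 1) * n.choose (n / 2) := by
        rw [← Nat.sum_range_choose]
        refine (Finset.sum_le_card_nsmul _ _ _ fun k _ => Nat.choose_le_middle k n).trans ?_
        rw [Finset.card_range, smul_eq_mul]
      exact_mod_cast h1
    have hC' : (2 : ℝ) ^ n / (n + 1) ≤ n.choose (n / 2) := by
      rw [div_le_iff₀ (by positivity)]
      linarith
    rw [burnsideStationary, card_orbit_coordPerm, valueCount_halfState, div_div_eq_mul_div, div_one,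
      mul_comm]
    gcongr
    · exact (Real.exp_pos _).le.trans (hret _)
    · exact hret _
    · exact hC'.trans (le_mul_of_one_le_left (Nat.cast_nonneg _) hZ)

theorem tendsto_lower_bound :
    Tendsto (fun n : ℕ => (2 : ℝ) ^ n / (n + 1) * Real.exp (-(0.4 * n)) - 1) atTop atTop := by
  have h : Tendsto (fun n : ℕ => 0.01 * (n : ℝ) - 1) atTop atTop :=
    tendsto_atTop_add_const_right _ _
      (tendsto_natCast_atTop_atTop.const_mul_atTop (by norm_num))
  refine tendsto_atTop_mono' _ ?_ h
  filter_upwards [eventually_ge_atTop 1] with n hn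
  have hn' : (1 : ℝ) ≤ n := by exact_mod_cast hn
  -- Since `log 2 > 0.6`, a net growth `exp (0.2 n)` remains, whose quadratic Taylor term beats
  -- `0.01 n (n + 1)`.
  have h2 : Real.exp (0.6 * n) ≤ 2 ^ n := by
    rw [← Real.rpow_natCast, Real.rpow_def_of_pos (by norm_num), Real.exp_le_exp]
    nlinarith [Real.log_two_gt_d9]
  have h3 := Real.quadratic_le_exp_of_nonneg (show (0 : ℝ) ≤ 0.2 * n by positivity)
  have h4 : Real.exp (0.6 * n) * Real.exp (-(0.4 * n)) = Real.exp (0.2 * n) := by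
    rw [← Real.exp_add]
    ring_nf
  have h5 := mul_le_mul_of_nonneg_right h2 (Real.exp_pos (-(0.4 * (n : ℝ)))).le
  rw [div_mul_eq_mul_div]
  refine sub_le_sub_right ?_ 1
  rw [le_div_iff₀ (by positivity)]
  nlinarith

theorem eigenvalue_term_le {n k l : ℕ} (hn : 2 ≤ n) (hlog : Real.log n ^ 2 ≤ √n) (hk : 1 ≤ k)
    (hl : 10 * (n : ℝ) / Real.log (n : ℝ) ≤ (l : ℝ)) :
    (n.choose (2 * k) : ℝ) * burnsideEigenvalue k ^ (2 * l) ≤ Real.exp (-√n) := by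
  have hn0 : (0 : ℝ) < n := by positivity
  have hn1 : (2 : ℝ) ≤ n := by exact_mod_cast hn
  have hk' : (1 : ℝ) ≤ k := by exact_mod_cast hk
  have hL : 0 < Real.log n := Real.log_pos (by linarith)
  have hs : √(n : ℝ) * √n = n := Real.mul_self_sqrt hn0.le
  have hs1 : 1 ≤ √(n : ℝ) := Real.one_le_sqrt.2 (by linarith)
  rw [div_le_iff₀ hL] at hl
  have hβ := burnsideEigenvalue_le k
  -- For small `k` the binomial is only `exp (√n log n)`, so eigenvalue at most 1/3 < 1/e suffices.
  -- For large `k` the binomial may reach `2^n`, but the eigenvalue is below `1/√n`, so its power is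
  -- at most `exp (-10 n)`.
  rcases le_or_gt (2 * (k : ℝ)) (√n) with hks | hks
  · have h1 : (n.choose (2 * k) : ℝ) ≤ Real.exp (√n * Real.log n) := by
      calc (n.choose (2 * k) : ℝ) ≤ (n : ℝ) ^ (2 * k) := by exact_mod_cast Nat.choose_le_pow n (2 * k)
        _ = Real.exp ((2 * k : ℕ) * Real.log n) := by rw [Real.exp_nat_mul, Real.exp_log hn0]
        _ ≤ _ := by
          rw [Real.exp_le_exp]
          push_cast
          exact mul_le_mul_of_nonneg_right hks hL.le
    have h2 : burnsideEigenvalue k ^ (2 * l) ≤ Real.exp (-(2 * l)) := by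
      have h3 : burnsideEigenvalue k ≤ Real.exp (-1) := by
        refine hβ.trans ?_
        rw [Real.exp_neg, ← one_div]
        exact one_div_le_one_div_of_le (Real.exp_pos 1) (by linarith [Real.exp_one_lt_d9])
      refine (pow_le_pow_left₀ (burnsideEigenvalue_nonneg k) h3 _).trans ?_
      rw [← Real.exp_nat_mul]
      push_cast
      rw [mul_neg_one]
    refine (mul_le_mul h1 h2 (pow_nonneg (burnsideEigenvalue_nonneg k) _)
      (Real.exp_pos _).le).trans ?_
    rw [← Real.exp_add, Real.exp_le_exp]
    have h4 : Real.log n ≤ 2 * √n := by nlinarith [sq_nonneg (Real.log n - 1)]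
    -- The left side is at most `3n` by `hlog` and `h4`, the right side at least `20n` by `hl`.
    have h5 : (√n * Real.log n + √n) * Real.log n ≤ 2 * l * Real.log n := by nlinarith
    have h6 := le_of_mul_le_mul_right h5 hL
    linarith
  · have h1 : (n.choose (2 * k) : ℝ) ≤ Real.exp n := by
      have h3 : (n.choose (2 * k) : ℝ) ≤ 2 ^ n := by exact_mod_cast Nat.choose_le_two_pow n (2 * k)
      refine h3.trans ?_
      rw [← mul_one (n : ℝ), Real.exp_nat_mul]
      exact pow_le_pow_left₀ (by norm_num) (by linarith [Real.add_one_le_exp 1]) _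
    have h2 : burnsideEigenvalue k ^ (2 * l) ≤ Real.exp (-(10 * n)) := by
      have h3 : burnsideEigenvalue k ≤ Real.exp (-(Real.log n / 2)) := by
        refine hβ.trans ?_
        rw [Real.exp_neg, ← one_div, Real.exp_half, Real.exp_log hn0]
        exact one_div_le_one_div_of_le (by positivity) (by linarith)
      refine (pow_le_pow_left₀ (burnsideEigenvalue_nonneg k) h3 _).trans ?_
      rw [← Real.exp_nat_mul, Real.exp_le_exp]
      push_cast
      linarith
    refine (mul_le_mul h1 h2 (pow_nonneg (burnsideEigenvalue_nonneg k) _)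
      (Real.exp_pos _).le).trans ?_
    rw [← Real.exp_add, Real.exp_le_exp]
    nlinarith

theorem binaryChiSqAvg_le {n l : ℕ} (hn : 2 ≤ n) (hlog : Real.log n ^ 2 ≤ √n)
    (hl : 10 * (n : ℝ) / Real.log (n : ℝ) ≤ (l : ℝ)) :
    binaryChiSqAvg n l ≤ n * Real.exp (-√n) := by
  have hn1 : (2 : ℝ) ≤ n := by exact_mod_cast hn
  have hL : 0 < Real.log n := Real.log_pos (by linarith)
  have hl1 : 1 ≤ l := by
    have : (0 : ℝ) < l := lt_of_lt_of_le (by positivity) hl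
    exact_mod_cast this
  rw [binaryChiSqAvg_eq n hl1]
  refine (Finset.sum_le_card_nsmul _ _ _ fun k hk =>
    eigenvalue_term_le hn hlog (Finset.mem_Icc.1 hk).1 hl).trans ?_
  rw [Nat.card_Icc, nsmul_eq_mul]
  refine mul_le_mul_of_nonneg_right ?_ (Real.exp_pos _).le
  exact_mod_cast (show n / 2 + 1 - 1 ≤ n by omega)

theorem eventually_log_sq_le_sqrt : ∀ᶠ n : ℕ in atTop, Real.log n ^ 2 ≤ √(n : ℝ) := by
  have h := (isLittleO_log_rpow_atTop (show (0 : ℝ) < 1 / 4 by norm_num)).bound one_pos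
  filter_upwards [tendsto_natCast_atTop_atTop.eventually h] with n hn
  rw [one_mul, Real.norm_eq_abs, Real.norm_eq_abs, abs_of_nonneg (Real.rpow_nonneg n.cast_nonneg _)]
    at hn
  rw [← sq_abs]
  refine (pow_le_pow_left₀ (abs_nonneg _) hn 2).trans_eq ?_
  rw [← Real.rpow_natCast, ← Real.rpow_mul n.cast_nonneg, Real.sqrt_eq_rpow]
  norm_num

theorem tendsto_upper_bound :
    Tendsto (fun n : ℕ => ((n : ℝ) + 1) * (n * Real.exp (-√n))) atTop (nhds 0) := by
  -- With `u = √n`, the prefactor satisfies `(n + 1) n ≤ 2 u^4`.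
  have h := ((Real.tendsto_pow_mul_exp_neg_atTop_nhds_zero 4).comp
    (Real.tendsto_sqrt_atTop.comp (tendsto_natCast_atTop_atTop (R := ℝ)))).const_mul 2
  rw [mul_zero] at h
  refine squeeze_zero' (Eventually.of_forall fun n => by positivity) ?_ h
  filter_upwards [eventually_ge_atTop 1] with n hn
  have hn' : (1 : ℝ) ≤ n := by exact_mod_cast hn
  have h4 : √(n : ℝ) ^ 4 = n * n := by
    rw [show 4 = 2 * 2 by norm_num, pow_mul, Real.sq_sqrt n.cast_nonneg, sq]
  simp only [Function.comp_apply, h4]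
  rw [← mul_assoc, ← mul_assoc]
  exact mul_le_mul_of_nonneg_right (by nlinarith) (Real.exp_pos _).le

end ChiSquare

theorem theorem1p1 :
    (∀ n l : ℕ, 1 ≤ l →
      binaryChiSqAvg n l =
        ∑ k ∈ Finset.Icc 1 (n / 2),
          (n.choose (2 * k) : ℝ) *
            (1 / (2 : ℝ) ^ (4 * k) * ((2 * k).choose k : ℝ) ^ 2) ^ (2 * l)) ∧
    (∀ M : ℝ, ∀ᶠ n : ℕ in atTop, ∀ l : ℕ,
      (l : ℝ) ≤ 0.1 * (n : ℝ) / Real.log (n : ℝ) →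
        M ≤ binaryChiSqAvg n l ∧ M ≤ binaryChiSq n l (halfState n)) ∧
    (∀ ε : ℝ, 0 < ε → ∀ᶠ n : ℕ in atTop, ∀ l : ℕ,
      10 * (n : ℝ) / Real.log (n : ℝ) ≤ (l : ℝ) →
        |binaryChiSqAvg n l| < ε ∧ ∀ x : BinaryTuple n, |binaryChiSq n l x| < ε) := by
  refine ⟨fun n l hl => binaryChiSqAvg_eq n hl, fun M => ?_, fun ε hε => ?_⟩
  · filter_upwards [eventually_ge_atTop 2, tendsto_lower_bound.eventually_ge_atTop M]
      with n hn hM l hl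
    have h := binaryChiSq_lower hn hl
    exact ⟨hM.trans h.1, hM.trans h.2⟩
  · filter_upwards [eventually_ge_atTop 2, eventually_log_sq_le_sqrt,
      tendsto_upper_bound.eventually_lt_const hε] with n hn hlog hlt l hl
    have h1 : ((n : ℝ) + 1) * binaryChiSqAvg n l < ε :=
      (mul_le_mul_of_nonneg_left (binaryChiSqAvg_le hn hlog hl) (by positivity)).trans_lt hlt
    have h0 := binaryChiSqAvg_nonneg n l
    refine ⟨?_, fun x => ?_⟩
    · rw [abs_of_nonneg h0]
      nlinarith [(Nat.cast_nonneg n : (0 : ℝ) ≤ n)]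
    · rw [abs_of_nonneg (binaryChiSq_nonneg n l x)]
      exact (binaryChiSq_le n l x).trans_lt h1
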